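/- Let $I=[0,1]$ and let $C(I,\mathbb R^2)$ be the real vector space of continuous maps $I\to\mathbb R^2$ with the topology of uniform convergence. A subset $A$ of a topological vector space $X$ is called maximal dense-lineable in $X$ if there is a dense vector subspace $M$ of $X$ with $M\setminus\{0\}\subset A$ and $\dim M=\dim X$ (algebraic dimension). Let $\mathcal{TSF}$ be the set of all $\varphi\in C(I,\mathbb R^2)$ whose image $\varphi(I)$ has nonempty interior in $\mathbb R^2$, and let $\lambda\text{-}\mathcal{SF}$ be the set of all $\varphi\in C(I,\mathbb R^2)$ with $\lambda(\varphi(I))>0$, where $\lambda$ is Lebesgue measure on $\mathbb R^2$. Theorem. $\dim C(I,\mathbb R^2)=\mathfrak c$, the cardinality of the continuum, and the family $\mathcal{TSF}$ is maximal dense-lineable in $C(I,\mathbb R^2)$; that is, there is a dense vector subspace $M$ of $C(I,\mathbb R^2)$ with $\dim M=\dim C(I,\mathbb R^2)=\mathfrak c$ and $M\setminus\{0\}\subset\mathcal{TSF}$. Hence the family $\lambda\text{-}\mathcal{SF}$ is maximal dense-lineable in $C(I,\mathbb R^2)$ as well. -/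

import Mathlib

/-- A subset `A` of a topological vector space `X` over `𝕜` is maximal dense-lineable in `X` if
there is a dense vector subspace `M` of `X` with `M \ {0} ⊆ A` and `dim M = dim X`
(algebraic dimensions, as cardinal numbers). -/
def MaximalDenseLineable (𝕜 : Type*) {X : Type*} [Field 𝕜] [AddCommGroup X] [Module 𝕜 X]
    [TopologicalSpace X] (A : Set X) : Prop :=
  ∃ M : Submodule 𝕜 X, Dense (M : Set X) ∧ (M : Set X) \ {0} ⊆ A ∧
    Module.rank 𝕜 M = Module.rank 𝕜 X

/-- The topologically space-filling curves: continuous maps `φ : [0,1] → ℝ²` whose image has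
nonempty interior. The plane is `ℝ × ℝ` with its maximum norm, and `C([0,1], ℝ²)` carries the
topology of uniform convergence, which is that of its supremum norm. -/
def topologicallySpaceFilling : Set C(unitInterval, ℝ × ℝ) :=
  {φ | (interior (Set.range φ)).Nonempty}

/-- The `λ`-space-filling curves: continuous maps `φ : [0,1] → ℝ²` whose image has positive
planar Lebesgue measure. -/
def lebesgueSpaceFilling : Set C(unitInterval, ℝ × ℝ) :=
  {φ | 0 < (MeasureTheory.volume : MeasureTheory.Measure (ℝ × ℝ)) (Set.range φ)}

/-! Let `P = (u, p)` map onto `I × I²` and set `ψ_r = u ^ r • p` for `r > 0`. A combination of the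
`ψ_r` is `(∑ c_r u ^ r) • p`. The powers are linearly independent, so the factor is nonzero at some
`u`, and the slice over that `u` covers a square. Shrunken copies of `ψ_r` give `φ_r` that do this
arbitrarily near `0`. Index all pairs `(f, n)` by `r` and add `φ_r / (n + 1)` to `f` delayed by `1 /
(n + 1)`. Near `0` the delayed parts are constant, so combinations still cover a square; as `n → ∞`
these curves tend to `f`, whence density. -/

open Set in
/-- A continuous map from the real line that sends `[0,1]` onto the cube. -/
theorem exists_continuous_image_Icc_eq_cube :
    ∃ P : C(ℝ, unitInterval × unitInterval × unitInterval),
      ∀ y, ∃ x ∈ Icc (0 : ℝ) 1, P x = y := by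
  obtain ⟨q, hq, hs⟩ := exists_nat_bool_continuous_surjective_of_compact
    (unitInterval × unitInterval × unitInterval)
  obtain ⟨P, hP⟩ := ContinuousMap.exists_restrict_eq isClosed_cantorSet
    (⟨fun x => q (cantorSetHomeomorphNatToBool x), by fun_prop⟩ :
      C(cantorSet, unitInterval × unitInterval × unitInterval))
  refine ⟨P, fun y => ?_⟩
  obtain ⟨b, rfl⟩ := hs y
  refine ⟨cantorSetHomeomorphNatToBool.symm b,
    cantorSet_subset_unitInterval (cantorSetHomeomorphNatToBool.symm b).2, ?_⟩
  have h := DFunLike.congr_fun hP (cantorSetHomeomorphNatToBool.symm b)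
  simpa using h

/-- A trapezoidal bump, equal to `1` on `[0,1]` and to `0` outside `(-1/2, 3/2)`. -/
noncomputable def trapezoid (x : ℝ) : ℝ := max 0 (min 1 (2 - 2 * |x - 1 / 2|))

theorem continuous_trapezoid : Continuous trapezoid := by
  unfold trapezoid; fun_prop

theorem trapezoid_nonneg (x : ℝ) : 0 ≤ trapezoid x := le_max_left _ _

theorem trapezoid_le_one (x : ℝ) : trapezoid x ≤ 1 :=
  max_le zero_le_one (min_le_left _ _)

theorem trapezoid_eq_one {x : ℝ} (h0 : 0 ≤ x) (h1 : x ≤ 1) : trapezoid x = 1 := by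
  have : |x - 1 / 2| ≤ 1 / 2 := abs_le.2 ⟨by linarith, by linarith⟩
  rw [trapezoid, min_eq_left (by linarith), max_eq_right zero_le_one]

theorem trapezoid_eq_zero {x : ℝ} (h : 1 ≤ |x - 1 / 2|) : trapezoid x = 0 := by
  rw [trapezoid, max_eq_left ((min_le_right _ _).trans (by linarith))]

/-- Scaled copies of a bounded curve can be placed in disjoint intervals shrinking to `0`. -/
theorem exists_shrinking_copies {E : Type*} [NormedAddCommGroup E] [NormedSpace ℝ E]
    [CompleteSpace E] (ψ : C(ℝ, E)) (hψ : ∀ x, ‖ψ x‖ ≤ 1) :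
    ∃ φ : C(unitInterval, E), ‖φ‖ ≤ 1 ∧ ∀ (k : ℕ) (x : ℝ), 0 ≤ x → x ≤ 1 →
      ∀ t : unitInterval, (t : ℝ) = (1 + x) / 8 ^ (k + 1) → φ t = (1 / 2 / 2 ^ k : ℝ) • ψ x := by
  -- The `k`-th bump lives on `(1/2, 5/2) / 8 ^ (k + 1)`; the ratio `8 > 5` keeps these intervals
  -- disjoint.
  set F : ℕ → unitInterval → E := fun k t =>
    ((1 / 2 / 2 ^ k : ℝ) * trapezoid (8 ^ (k + 1) * t - 1)) • ψ (8 ^ (k + 1) * t - 1) with hF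
  have hsum : Summable fun k : ℕ => (1 / 2 / 2 ^ k : ℝ) := by
    simpa using summable_geometric_two' 1
  have hFle : ∀ k t, ‖F k t‖ ≤ 1 / 2 / 2 ^ k := fun k t => by
    have hk : (0 : ℝ) ≤ 1 / 2 / 2 ^ k := by positivity
    rw [hF, norm_smul, norm_mul, Real.norm_of_nonneg hk, Real.norm_of_nonneg (trapezoid_nonneg _),
      mul_assoc]
    exact mul_le_of_le_one_right hk (mul_le_one₀ (trapezoid_le_one _) (norm_nonneg _) (hψ _))
  have hcont : Continuous fun t => ∑' k, F k t := by
    refine continuous_tsum (fun k => ?_) hsum hFle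
    have := continuous_trapezoid
    fun_prop
  refine ⟨⟨_, hcont⟩, ?_, fun k x hx0 hx1 t ht => ?_⟩
  · refine (ContinuousMap.norm_le _ zero_le_one).2 fun t => ?_
    have h1 := tsum_of_norm_bounded hsum.hasSum (fun k => hFle k t)
    rwa [tsum_geometric_two' 1] at h1
  · have hp : (0 : ℝ) < 8 ^ (k + 1) := by positivity
    have hkx : (8 : ℝ) ^ (k + 1) * t - 1 = x := by rw [ht]; field_simp; ring
    change ∑' k, F k t = _
    rw [tsum_eq_single k]
    · simp only [hF]
      rw [hkx, trapezoid_eq_one hx0 hx1, mul_one]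
    · intro j hj
      have : trapezoid (8 ^ (j + 1) * t - 1) = 0 := by
        apply trapezoid_eq_zero
        have hy : (8 : ℝ) ^ (k + 1) * t = 1 + x := by linarith
        have ht0 : 0 ≤ (t : ℝ) := t.2.1
        rcases lt_or_gt_of_ne hj with h | h
        · have h8 : (8 : ℝ) ^ (j + 1) * 8 ≤ 8 ^ (k + 1) := by
            rw [← pow_succ]; exact pow_le_pow_right₀ (by norm_num) (by omega)
          have := mul_le_mul_of_nonneg_right h8 ht0
          exact le_abs.2 (Or.inr (by linarith))
        · have h8 : (8 : ℝ) ^ (k + 1) * 8 ≤ 8 ^ (j + 1) := by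
            rw [← pow_succ]; exact pow_le_pow_right₀ (by norm_num) (by omega)
          have := mul_le_mul_of_nonneg_right h8 ht0
          exact le_abs.2 (Or.inl (by linarith))
      simp [hF, this]

/-- The power function with positive exponent as a multiplicative map on the unit interval. -/
noncomputable def unitIntervalRpow (r : Set.Ioi (0 : ℝ)) : unitInterval →* ℝ where
  toFun s := (s : ℝ) ^ (r : ℝ)
  map_one' := by simp
  map_mul' s t := by simp [Real.mul_rpow s.2.1 t.2.1]

theorem unitIntervalRpow_injective : Function.Injective unitIntervalRpow := by
  intro r r' h
  have h2 : ((1 / 2 : ℝ)) ^ (r : ℝ) = (1 / 2 : ℝ) ^ (r' : ℝ) :=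
    DFunLike.congr_fun h (⟨1 / 2, by norm_num, by norm_num⟩ : unitInterval)
  exact Subtype.ext ((Real.rpow_right_inj (by norm_num) (by norm_num)).1 h2)

/-- Dedekind's independence of distinct characters. -/
theorem linearIndependent_unitIntervalRpow :
    LinearIndependent ℝ fun (r : Set.Ioi (0 : ℝ)) (s : unitInterval) => unitIntervalRpow r s :=
  (linearIndependent_monoidHom unitInterval ℝ).comp _ unitIntervalRpow_injective

/-- Continuum many curves all of whose nontrivial linear combinations cover, arbitrarily close to
the parameter `0`, a nondegenerate square. -/
theorem exists_curves_combinations_cover_square :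
    ∃ φ : Set.Ioi (0 : ℝ) → C(unitInterval, ℝ × ℝ), (∀ r, ‖φ r‖ ≤ 1) ∧
      ∀ (s : Finset (Set.Ioi (0 : ℝ))) (c : Set.Ioi (0 : ℝ) → ℝ), (∃ r ∈ s, c r ≠ 0) →
        ∀ δ > 0, ∃ a : ℝ, a ≠ 0 ∧ ∀ p : unitInterval × unitInterval, ∃ t : unitInterval,
          (t : ℝ) ≤ δ ∧ ∑ r ∈ s, c r • φ r t = a • ((p.1 : ℝ), (p.2 : ℝ)) := by
  obtain ⟨P, hP⟩ := exists_continuous_image_Icc_eq_cube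
  have key : ∀ r : Set.Ioi (0 : ℝ), ∃ φ : C(unitInterval, ℝ × ℝ), ‖φ‖ ≤ 1 ∧
      ∀ (k : ℕ) (x : ℝ), 0 ≤ x → x ≤ 1 → ∀ t : unitInterval, (t : ℝ) = (1 + x) / 8 ^ (k + 1) →
        φ t = (1 / 2 / 2 ^ k : ℝ) • (unitIntervalRpow r (P x).1) •
          (((P x).2.1 : ℝ), ((P x).2.2 : ℝ)) := fun r => by
    have hr : (0 : ℝ) < r := r.2
    refine exists_shrinking_copies ⟨fun x => (unitIntervalRpow r (P x).1) •
          (((P x).2.1 : ℝ), ((P x).2.2 : ℝ)), ?_⟩ fun x => ?_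
    · have h1 : Continuous fun x => unitIntervalRpow r (P x).1 := by
        change Continuous fun x => (((P x).1 : ℝ)) ^ (r : ℝ)
        exact Continuous.rpow_const (by fun_prop) fun _ => Or.inr hr.le
      fun_prop
    · have h0 : 0 ≤ unitIntervalRpow r (P x).1 := Real.rpow_nonneg (P x).1.2.1 _
      have h1 : unitIntervalRpow r (P x).1 ≤ 1 :=
        Real.rpow_le_one (P x).1.2.1 (P x).1.2.2 hr.le
      simp only [ContinuousMap.coe_mk, norm_smul, Prod.norm_def, Real.norm_of_nonneg h0,
        Real.norm_of_nonneg (P x).2.1.2.1, Real.norm_of_nonneg (P x).2.2.2.1]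
      exact mul_le_one₀ h1 (le_max_of_le_left (P x).2.1.2.1)
        (max_le (P x).2.1.2.2 (P x).2.2.2.2)
  choose φ hφ1 hφ using key
  refine ⟨φ, hφ1, fun s c hc δ hδ => ?_⟩
  obtain ⟨u, hu⟩ : ∃ u : unitInterval, ∑ r ∈ s, c r * unitIntervalRpow r u ≠ 0 := by
    by_contra! h
    obtain ⟨r, hr, hcr⟩ := hc
    refine hcr (linearIndependent_iff'.1 linearIndependent_unitIntervalRpow s c ?_ r hr)
    ext u
    simpa [Finset.sum_apply] using h u
  obtain ⟨k, hk⟩ := exists_pow_lt_of_lt_one (show 0 < δ / 2 by positivity)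
    (show (1 / 8 : ℝ) < 1 by norm_num)
  refine ⟨(1 / 2 / 2 ^ k : ℝ) * ∑ r ∈ s, c r * unitIntervalRpow r u,
    mul_ne_zero (by positivity) hu, fun p => ?_⟩
  -- With the first coordinate frozen at `u`, the scalar factor does not depend on `p`.
  obtain ⟨x, ⟨hx0, hx1⟩, hx⟩ := hP (u, p)
  have hp : (1 : ℝ) ≤ 8 ^ k := one_le_pow₀ (by norm_num)
  have hle : (1 + x) / 8 ^ (k + 1) ≤ 2 * (1 / 8) ^ k := by
    rw [div_pow, one_pow, pow_succ, div_le_iff₀ (by positivity)]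
    field_simp
    linarith
  have hle1 : (1 + x) / 8 ^ (k + 1) ≤ 1 := by
    rw [div_le_one (by positivity), pow_succ]
    linarith
  refine ⟨⟨(1 + x) / 8 ^ (k + 1), by positivity, hle1⟩, by simp only; linarith, ?_⟩
  rw [Finset.sum_congr rfl fun r _ => by rw [hφ r k x hx0 hx1 _ rfl, hx], Finset.mul_sum,
    Finset.sum_smul]
  refine Finset.sum_congr rfl fun r _ => ?_
  simp only [smul_smul]
  congr 1
  ring

theorem interior_nonempty_of_forall_add_smul_mem {S : Set (ℝ × ℝ)} (b : ℝ × ℝ) {a : ℝ}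
    (ha : a ≠ 0)
    (h : ∀ p : unitInterval × unitInterval, b + a • ((p.1 : ℝ), (p.2 : ℝ)) ∈ S) :
    (interior S).Nonempty := by
  have hopen : IsOpen ((fun p : ℝ × ℝ => b + a • p) '' (Set.Ioo 0 1 ×ˢ Set.Ioo 0 1)) :=
    ((Homeomorph.smulOfNeZero a ha).trans (Homeomorph.addLeft b)).isOpenMap _
      (isOpen_Ioo.prod isOpen_Ioo)
  refine ⟨b + a • (1 / 2, 1 / 2), interior_maximal ?_ hopen ⟨(1 / 2, 1 / 2), by norm_num, rfl⟩⟩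
  rintro _ ⟨p, ⟨h1, h2⟩, rfl⟩
  exact h (⟨p.1, h1.1.le, h1.2.le⟩, ⟨p.2, h2.1.le, h2.2.le⟩)

/-- Truncated translation to the left on the unit interval, constant on `[0, 1/(n+1)]`. -/
noncomputable def unitIntervalShift (n : ℕ) : C(unitInterval, unitInterval) where
  toFun t := ⟨max 0 ((t : ℝ) - 1 / (n + 1)), le_max_left _ _,
    max_le zero_le_one (by have := t.2.2; have : (0 : ℝ) < 1 / (n + 1) := by positivity
                           linarith)⟩
  continuous_toFun := by fun_prop

theorem unitIntervalShift_eq_zero {n : ℕ} {t : unitInterval} (ht : (t : ℝ) ≤ 1 / (n + 1)) :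
    unitIntervalShift n t = 0 :=
  Subtype.ext (max_eq_left (by linarith))

theorem dist_unitIntervalShift_le (n : ℕ) (t : unitInterval) :
    dist (unitIntervalShift n t) t ≤ 1 / (n + 1) := by
  have h0 : (0 : ℝ) < 1 / (n + 1) := by positivity
  have ht := t.2.1
  rw [Subtype.dist_eq, Real.dist_eq, abs_le]
  change _ ≤ max 0 ((t : ℝ) - 1 / (n + 1)) - t ∧ max 0 ((t : ℝ) - 1 / (n + 1)) - t ≤ _
  refine ⟨?_, ?_⟩
  · linarith [le_max_right 0 ((t : ℝ) - 1 / (n + 1))]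
  · rw [sub_le_iff_le_add]; exact max_le (by linarith) (by linarith)

open Filter Topology in
theorem tendsto_comp_unitIntervalShift {E : Type*} [PseudoMetricSpace E]
    (f : C(unitInterval, E)) :
    Tendsto (fun n => f.comp (unitIntervalShift n)) atTop (𝓝 f) := by
  rw [ContinuousMap.tendsto_iff_tendstoUniformly, Metric.tendstoUniformly_iff]
  intro ε hε
  obtain ⟨δ, hδ, h⟩ := Metric.uniformContinuous_iff.1
    (CompactSpace.uniformContinuous_of_continuous f.continuous) ε hε
  filter_upwards [(tendsto_one_div_add_atTop_nhds_zero_nat (𝕜 := ℝ)).eventually_lt_const hδ]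
    with n hn t
  rw [dist_comm]
  exact h ((dist_unitIntervalShift_le n t).trans_lt hn)

open Cardinal in
theorem mk_curves_le_continuum : #C(unitInterval, ℝ × ℝ) ≤ 𝔠 := by
  obtain ⟨s, hs, hd⟩ := TopologicalSpace.exists_countable_dense unitInterval
  have hinj : Function.Injective fun (f : C(unitInterval, ℝ × ℝ)) (x : s) => f x := by
    intro f g h
    exact DFunLike.coe_injective (f.continuous.ext_on hd g.continuous
      fun x hx => congrFun h ⟨x, hx⟩)
  refine (mk_le_of_injective hinj).trans ?_
  rw [← Cardinal.power_def, mk_prod, lift_id, mk_real, continuum_mul_self]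
  calc 𝔠 ^ #s ≤ 𝔠 ^ ℵ₀ := power_le_power_left continuum_ne_zero (le_aleph0_iff_set_countable.2 hs)
    _ = 𝔠 := continuum_power_aleph0

open Filter Topology Cardinal in
theorem exists_dense_submodule_topologicallySpaceFilling :
    ∃ M : Submodule ℝ C(unitInterval, ℝ × ℝ), Dense (M : Set C(unitInterval, ℝ × ℝ)) ∧
      (M : Set C(unitInterval, ℝ × ℝ)) \ {0} ⊆ topologicallySpaceFilling ∧
      Module.rank ℝ M = 𝔠 := by
  obtain ⟨φ, hφ1, hφ⟩ := exists_curves_combinations_cover_square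
  -- There are only `𝔠` pairs, so the exponents can enumerate them all.
  obtain ⟨e, he⟩ : ∃ e : Set.Ioi (0 : ℝ) → C(unitInterval, ℝ × ℝ) × ℕ, Function.Surjective e := by
    have : #(C(unitInterval, ℝ × ℝ) × ℕ) ≤ #(Set.Ioi (0 : ℝ)) := by
      rw [mk_prod, lift_id, lift_id, mk_Ioi_real, mk_nat]
      exact (mul_le_mul' mk_curves_le_continuum le_rfl).trans continuum_mul_aleph0.le
    obtain ⟨i⟩ := this
    exact ⟨_, Function.invFun_surjective i.injective⟩
  set v : Set.Ioi (0 : ℝ) → C(unitInterval, ℝ × ℝ) := fun r =>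
    (e r).1.comp (unitIntervalShift (e r).2) + (1 / ((e r).2 + 1) : ℝ) • φ r with hv
  have hcomb : ∀ (s : Finset (Set.Ioi (0 : ℝ))) (c : Set.Ioi (0 : ℝ) → ℝ),
      (∃ r ∈ s, c r ≠ 0) → ∑ r ∈ s, c r • v r ∈ topologicallySpaceFilling := by
    intro s c hc
    obtain ⟨N, hN⟩ : ∃ N : ℕ, ∀ r ∈ s, (e r).2 ≤ N :=
      ⟨s.sup fun r => (e r).2, fun r hr => Finset.le_sup (f := fun r => (e r).2) hr⟩
    obtain ⟨a, ha, h⟩ := hφ s (fun r => c r * (1 / ((e r).2 + 1)))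
      (by obtain ⟨r, hr, hcr⟩ := hc; exact ⟨r, hr, mul_ne_zero hcr (by positivity)⟩)
      (1 / (N + 1)) (by positivity)
    -- On `[0, 1 / (N + 1)]` every delayed `f` involved still has its value at `0`.
    refine interior_nonempty_of_forall_add_smul_mem (∑ r ∈ s, c r • (e r).1 0) ha fun p => ?_
    obtain ⟨t, ht, hp⟩ := h p
    refine ⟨t, ?_⟩
    rw [← hp, ← Finset.sum_add_distrib, ContinuousMap.sum_apply]
    refine Finset.sum_congr rfl fun r hr => ?_
    have hrN : ((e r).2 : ℝ) ≤ N := by exact_mod_cast hN r hr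
    have hshift : unitIntervalShift (e r).2 t = 0 := unitIntervalShift_eq_zero
      (ht.trans (one_div_le_one_div_of_le (by positivity) (by linarith)))
    simp only [hv, ContinuousMap.smul_apply, ContinuousMap.add_apply, ContinuousMap.comp_apply,
      hshift, smul_add, smul_smul]
  have hzero : (0 : C(unitInterval, ℝ × ℝ)) ∉ topologicallySpaceFilling := by
    rintro ⟨x, hx⟩
    have hr : Set.range (0 : C(unitInterval, ℝ × ℝ)) = {0} := Set.range_const
    rw [hr, interior_singleton] at hx
    exact hx
  -- Independence is free: a vanishing nontrivial combination would make `0` space-filling.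
  have hli : LinearIndependent ℝ v := linearIndependent_iff'.2 fun s c h0 r hr => by
    by_contra hcr
    exact hzero (h0 ▸ hcomb s c ⟨r, hr, hcr⟩)
  refine ⟨Submodule.span ℝ (Set.range v), fun f => ?_, ?_, ?_⟩
  · choose g hg using fun n : ℕ => he (f, n)
    have hlim : Tendsto (fun n => v (g n)) atTop (𝓝 f) := by
      have h2 : Tendsto (fun n : ℕ => (1 / ((n : ℝ) + 1)) • φ (g n)) atTop (𝓝 0) := by
        refine squeeze_zero_norm (fun n => ?_) (tendsto_one_div_add_atTop_nhds_zero_nat (𝕜 := ℝ))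
        have hn : (0 : ℝ) ≤ 1 / ((n : ℝ) + 1) := by positivity
        rw [norm_smul, Real.norm_of_nonneg hn]
        exact mul_le_of_le_one_right hn (hφ1 _)
      simpa [hv, hg] using (tendsto_comp_unitIntervalShift f).add h2
    exact mem_closure_of_tendsto hlim
      (Eventually.of_forall fun n => Submodule.subset_span ⟨g n, rfl⟩)
  · rintro f ⟨hf, hf0⟩
    obtain ⟨c, rfl⟩ := (Finsupp.mem_span_range_iff_exists_finsupp).1 hf
    refine hcomb c.support c ?_
    by_contra! h
    exact hf0 (Finset.sum_eq_zero fun r hr => by simp [h r hr])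
  · rw [rank_span hli, mk_range_eq _ hli.injective, mk_Ioi_real]

theorem topologicallySpaceFilling_subset_lebesgueSpaceFilling :
    topologicallySpaceFilling ⊆ lebesgueSpaceFilling := fun _ h =>
  (isOpen_interior.measure_pos _ h).trans_le (MeasureTheory.measure_mono interior_subset)

theorem mainTheorem5 :
    Module.rank ℝ C(unitInterval, ℝ × ℝ) = Cardinal.continuum ∧
    MaximalDenseLineable ℝ topologicallySpaceFilling ∧
    MaximalDenseLineable ℝ lebesgueSpaceFilling := by
  obtain ⟨M, hd, hM, hr⟩ := exists_dense_submodule_topologicallySpaceFilling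
  have hrank : Module.rank ℝ C(unitInterval, ℝ × ℝ) = Cardinal.continuum :=
    le_antisymm ((rank_le_card ℝ _).trans mk_curves_le_continuum) (hr ▸ M.rank_le)
  exact ⟨hrank, ⟨M, hd, hM, hr.trans hrank.symm⟩,
    ⟨M, hd, hM.trans topologicallySpaceFilling_subset_lebesgueSpaceFilling,
      hr.trans hrank.symm⟩⟩
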